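/- Theorem (Kubota). Let $d\ge 1$ be an integer. For $m\ge 1$ let $\tilde F_d(m)$ be the number of all (complex-valued) primitive Dirichlet characters of conductor $m$ and of order dividing $d$, and for $\Re(s)>1$ put $$L_d(s)=\sum_{m=1}^\infty \tilde F_d(m)\,m^{-s},\qquad Z_d(s)=\prod_{t\mid d,\ t>1}\zeta_{\mathbb{Q}(\boldsymbol{\mu}_t)}(s),$$ where $\zeta_{\mathbb{Q}(\boldsymbol{\mu}_t)}$ is the Dedekind zeta function of the cyclotomic field $\mathbb{Q}(\boldsymbol{\mu}_t)$. For a prime $p$ let $$L_{d,p}(s)=\sum_{k\ge 0}\tilde F_d(p^k)\,p^{-ks},\qquad \mathcal{L}_{d,p}(s)=\prod_{t\mid d,\ t>1}\ \prod_{\mathfrak{p}\mid p\text{ in }\mathbb{Q}(\boldsymbol{\mu}_t)}\bigl(1-N(\mathfrak{p})^{-s}\bigr)$$ be the Euler factors at $p$ of $L_d(s)$ and of $Z_d(s)^{-1}$. Then for $\Re(s)>1$ the series $L_d(s)$ converges absolutely and $Z_d(s)\neq 0$, and there is an analytic function $H$ on the half plane $\Re(s)>1/2$ such that 1. $H(s)=L_d(s)/Z_d(s)$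 for $\Re(s)>1$; 2. $H(s)=\prod_p L_{d,p}(s)\,\mathcal{L}_{d,p}(s)$ on $\Re(s)>1/2$, where the product converges locally uniformly there and $\sum_p |L_{d,p}(s)\mathcal{L}_{d,p}(s)-1|<\infty$ for every such $s$; 3. $H(1)\neq 0$. -/

import Mathlib

open scoped NumberField

noncomputable section

/-- The number of primitive Dirichlet characters (with values in `ℂ`) of conductor `m` and of
order dividing `d`. -/
def primitiveCount (d m : ℕ) : ℕ :=
  Nat.card {χ : DirichletCharacter ℂ m // χ.IsPrimitive ∧ orderOf χ ∣ d}

/-- The coefficients of the Dirichlet series `L_d(s)`. -/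
def kubotaCoeff (d : ℕ) : ℕ → ℂ := fun m => (primitiveCount d m : ℂ)

/-- `L_d(s) = ∑_{m ≥ 1} F̃_d(m) m⁻ˢ`. -/
def kubotaL (d : ℕ) (s : ℂ) : ℂ := LSeries (kubotaCoeff d) s

/-- `Z_d(s)`, the product over the divisors `t > 1` of `d` of the Dedekind zeta functions of the
cyclotomic fields `ℚ(μ_t)` (in the half plane `Re s > 1` of convergence). -/
def kubotaZ (d : ℕ) (s : ℂ) : ℂ :=
  ∏ t ∈ d.divisors with 1 < t, NumberField.dedekindZeta (CyclotomicField t ℚ) s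

/-- The Euler factor of `L_d(s)` at `p`, namely `∑_{k ≥ 0} F̃_d(p ^ k) p ^ (-k s)`. -/
def kubotaLFactor (d p : ℕ) (s : ℂ) : ℂ :=
  ∑' k : ℕ, (primitiveCount d (p ^ k) : ℂ) * (p : ℂ) ^ (-(k : ℂ) * s)

/-- The Euler factor at `p` of `1 / ζ_K(s)`: the product of `1 - N(P)⁻ˢ` over the primes `P` of `K`
above `p`. -/
def dedekindZetaInvFactor (K : Type*) [Field K] [NumberField K] (p : ℕ) (s : ℂ) : ℂ :=
  ∏ᶠ P ∈ Ideal.primesOver (Ideal.span {(p : ℤ)}) (𝓞 K), (1 - (Ideal.absNorm P : ℂ) ^ (-s))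

/-- The Euler factor at `p` of `1 / Z_d(s)`. -/
def kubotaZInvFactor (d p : ℕ) (s : ℂ) : ℂ :=
  ∏ t ∈ d.divisors with 1 < t, dedekindZetaInvFactor (CyclotomicField t ℚ) p s

end

/-!
By Möbius inversion over conductors, `m ↦ F̃_d(m)` is multiplicative, so `L_d` has an Euler product.
At a prime `p ∤ d` there are no primitive characters of order dividing `d` modulo `p ^ k` for
`k ≥ 2`, and there are `n = gcd (p - 1, d) - 1` of them modulo `p`
(`primitiveCount_prime_pow_eq_zero`, `primitiveCount_prime_add_one`). Hence, with `x = p⁻ˢ`,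
the factor of `L_d` is `1 + n x`. The same prime is unramified in `ℚ(μ_t)` for `t ∣ d`, with residue
degree the order of `p` modulo `t`. The fields in which it splits completely are those with
`t ∣ p - 1`; together they contribute `(1 - x) ^ n` to the factor of `1 / Z_d`, because
`∑ φ(t) = n` over `1 < t ∣ gcd (p - 1, d)`. The other fields contribute `1 + O(x²)`. So the linear
terms cancel and the factor of `L_d / Z_d` is `1 + O(x²)` with a constant depending only on `d`
(`exists_norm_kubotaLFactor_mul_sub_one_le`). As `∑ p ^ (-2σ)` converges for `σ > 1/2`, the product
of these factors converges absolutely and locally uniformly on `Re s > 1/2`, and its limit is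
analytic. The finitely many primes dividing `d` contribute entire factors. An absolutely convergent
product vanishes only where one of its factors does, and at `s = 1` none does.

For `Re s > 1` the product is `L_d / Z_d` by the Euler products of `L_d` (`hasProd_kubotaLFactor`)
and of the Dedekind zeta functions (`hasProd_dedekindZetaInvFactor_inv`,
`dedekindZeta_ne_zero_and_hasProd`). The latter follows by unique factorization of ideals: the
ideals with prime factors in a finite set `T` are summed by induction on `T`, and `T` is then
exhausted by dominated convergence.
-/

/-! ### Counting characters of order dividing `d` -/

/-- The number of Dirichlet characters modulo `m` of order dividing `d` equals the number of units
`u` modulo `m` with `u ^ d = 1`, because a finite abelian group is isomorphic to its dual. -/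
lemma card_dirichletCharacter_pow_eq_one (d m : ℕ) [NeZero m] :
    Nat.card {χ : DirichletCharacter ℂ m // χ ^ d = 1} =
      Nat.card {u : (ZMod m)ˣ // u ^ d = 1} := by
  obtain ⟨e⟩ := DirichletCharacter.mulEquiv_units ℂ m
  refine Nat.card_congr (e.toEquiv.subtypeEquiv fun χ => ?_)
  change χ ^ d = 1 ↔ e χ ^ d = 1
  rw [← map_pow, map_eq_one_iff e e.injective]

lemma card_units_pow_eq_one_mul (d : ℕ) {m n : ℕ} (h : m.Coprime n) :
    Nat.card {u : (ZMod (m * n))ˣ // u ^ d = 1} =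
      Nat.card {u : (ZMod m)ˣ // u ^ d = 1} * Nat.card {u : (ZMod n)ˣ // u ^ d = 1} := by
  let e : (ZMod (m * n))ˣ ≃* (ZMod m)ˣ × (ZMod n)ˣ :=
    (Units.mapEquiv (ZMod.chineseRemainder h).toMulEquiv).trans MulEquiv.prodUnits
  rw [← Nat.card_prod]
  refine Nat.card_congr ((e.toEquiv.subtypeEquiv (q := fun v => v.1 ^ d = 1 ∧ v.2 ^ d = 1)
    fun u => ?_).trans (Equiv.subtypeProdEquivProd (p := fun u : (ZMod m)ˣ => u ^ d = 1)
      (q := fun u : (ZMod n)ˣ => u ^ d = 1)))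
  rw [← map_eq_one_iff e e.injective, map_pow, Prod.ext_iff]
  rfl

/-- Every character modulo `m` of order dividing `d` is induced by exactly one primitive character,
again of order dividing `d`, whose modulus divides `m`. -/
lemma sum_primitiveCount_divisors (d m : ℕ) [NeZero m] :
    ∑ k ∈ m.divisors, primitiveCount d k = Nat.card {u : (ZMod m)ˣ // u ^ d = 1} := by
  rw [← card_dirichletCharacter_pow_eq_one, ← Finset.sum_coe_sort]
  have hfin (k : m.divisors) :
      Finite {χ : DirichletCharacter ℂ k // χ.IsPrimitive ∧ orderOf χ ∣ d} := by
    have : NeZero (k : ℕ) := ⟨(Nat.pos_of_mem_divisors k.2).ne'⟩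
    infer_instance
  simp only [primitiveCount]
  rw [← Nat.card_sigma]
  refine Nat.card_congr (Equiv.ofBijective (fun x =>
    ⟨DirichletCharacter.changeLevel (Nat.dvd_of_mem_divisors x.1.2) x.2.1, ?_⟩) ⟨?_, ?_⟩)
  · rw [← map_pow, orderOf_dvd_iff_pow_eq_one.mp x.2.2.2, map_one]
  · rintro ⟨⟨k, hk⟩, χ, hχ, hχd⟩ ⟨⟨l, hl⟩, ψ, hψ, hψd⟩ h
    simp only [Subtype.mk.injEq] at h
    have hc := congr_arg DirichletCharacter.conductor h
    rw [DirichletCharacter.conductor_changeLevel, DirichletCharacter.conductor_changeLevel,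
      hχ, hψ] at hc
    subst hc
    obtain rfl := DirichletCharacter.changeLevel_injective _ h
    rfl
  · rintro ⟨χ, hχ⟩
    refine ⟨⟨⟨χ.conductor, Nat.mem_divisors.mpr ⟨χ.conductor_dvd_level, NeZero.ne m⟩⟩,
      χ.primitiveCharacter, χ.primitiveCharacter_isPrimitive, ?_⟩, ?_⟩
    · rw [orderOf_dvd_iff_pow_eq_one]
      apply DirichletCharacter.changeLevel_injective χ.conductor_dvd_level
      rw [map_pow, χ.changeLevel_primitiveCharacter, hχ, map_one]
    · exact Subtype.ext χ.changeLevel_primitiveCharacter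

lemma primitiveCount_one (d : ℕ) : primitiveCount d 1 = 1 := by
  have h := sum_primitiveCount_divisors d 1
  rwa [Nat.divisors_one, Finset.sum_singleton, Nat.card_eq_one_iff_unique.mpr
    ⟨inferInstance, ⟨1, one_pow d⟩⟩] at h

open ArithmeticFunction ArithmeticFunction.zeta ArithmeticFunction.Moebius in
/-- By Möbius inversion `primitiveCount d` is the Dirichlet convolution of two multiplicative
functions. -/
lemma primitiveCount_mul (d : ℕ) {m n : ℕ} (h : m.Coprime n) :
    primitiveCount d (m * n) = primitiveCount d m * primitiveCount d n := by
  let F : ArithmeticFunction ℤ := ⟨fun k => if k = 0 then 0 else primitiveCount d k, by simp⟩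
  let G : ArithmeticFunction ℤ :=
    ⟨fun k => if k = 0 then 0 else Nat.card {u : (ZMod k)ˣ // u ^ d = 1}, by simp⟩
  have hF {k : ℕ} (hk : k ≠ 0) : F k = primitiveCount d k := if_neg hk
  have hG {k : ℕ} (hk : k ≠ 0) : G k = Nat.card {u : (ZMod k)ˣ // u ^ d = 1} := if_neg hk
  have hGmul : G.IsMultiplicative := by
    rw [IsMultiplicative.iff_ne_zero]
    refine ⟨?_, fun {a b} ha hb hab => ?_⟩
    · rw [hG one_ne_zero, Nat.card_eq_one_iff_unique.mpr ⟨inferInstance, ⟨1, one_pow d⟩⟩,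
        Nat.cast_one]
    rw [hG ha, hG hb, hG (mul_ne_zero ha hb), card_units_pow_eq_one_mul d hab, Nat.cast_mul]
  have hFG : F * ζ = G := by
    ext k
    rcases eq_or_ne k 0 with rfl | hk
    · simp
    · have : NeZero k := ⟨hk⟩
      rw [coe_mul_zeta_apply, hG hk, ← sum_primitiveCount_divisors, Nat.cast_sum]
      exact Finset.sum_congr rfl fun i hi => hF (Nat.pos_of_mem_divisors hi).ne'
  have hFmul : F.IsMultiplicative := by
    have : F = G * μ := by rw [← hFG, mul_assoc, coe_zeta_mul_moebius, mul_one]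
    exact this ▸ hGmul.mul isMultiplicative_moebius
  rcases eq_or_ne m 0 with rfl | hm
  · obtain rfl : n = 1 := by simpa using h
    simp [primitiveCount_one]
  rcases eq_or_ne n 0 with rfl | hn
  · obtain rfl : m = 1 := by simpa using h
    simp [primitiveCount_one]
  have := hFmul.map_mul_of_coprime h
  rw [hF hm, hF hn, hF (mul_ne_zero hm hn)] at this
  exact_mod_cast this

/-- Since `(ℤ/p)ˣ` is cyclic of order `p - 1`, it has `gcd (p - 1, d)` characters of order dividing
`d`, and all of them but the trivial one are primitive. -/
lemma primitiveCount_prime_add_one (d : ℕ) {p : ℕ} (hp : p.Prime) :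
    primitiveCount d p + 1 = (p - 1).gcd d := by
  have : Fact p.Prime := ⟨hp⟩
  have h := sum_primitiveCount_divisors d p
  rw [hp.sum_divisors, primitiveCount_one] at h
  have h2 := IsCyclic.card_powMonoidHom_ker (G := (ZMod p)ˣ) d
  rw [Nat.card_eq_fintype_card (α := (ZMod p)ˣ), ZMod.card_units] at h2
  rw [h, ← h2]
  rfl

/-- If `k` is large in terms of the power `p ^ v` dividing `d`, then
`(1 + p ^ (k - 1 - v) b) ^ d = 1 + d p ^ (k - 1 - v) b` modulo `p ^ k`, so that every unit congruent
to `1` modulo `p ^ (k - 1)` is a `d`-th power. Characters of order dividing `d` are trivial on those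
units, hence not primitive. -/
lemma primitiveCount_prime_pow_eq_zero {d p v d' k : ℕ} (hp : p.Prime) (hd : d = p ^ v * d')
    (hd' : ¬ p ∣ d') (hk : 2 * v + 2 ≤ k) : primitiveCount d (p ^ k) = 0 := by
  have hp0 : NeZero (p ^ k) := ⟨pow_ne_zero _ hp.ne_zero⟩
  have hdvd : p ^ (k - 1) ∣ p ^ k := pow_dvd_pow p (Nat.sub_le k 1)
  rw [primitiveCount, Nat.card_eq_zero]
  refine Or.inl ⟨fun ⟨χ, hprim, hord⟩ => ?_⟩
  rw [orderOf_dvd_iff_pow_eq_one] at hord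
  suffices h : χ.FactorsThrough (p ^ (k - 1)) by
    have h1 := χ.conductor_dvd_of_mem_conductorSet h
    rw [hprim] at h1
    have := (Nat.pow_dvd_pow_iff_le_right hp.one_lt).mp h1
    omega
  rw [DirichletCharacter.factorsThrough_iff_ker_unitsMap hdvd]
  intro u hu
  rw [MonoidHom.mem_ker] at hu
  obtain ⟨c, hc⟩ : ∃ c : ZMod (p ^ k),
      (u : ZMod (p ^ k)) = 1 + (p : ZMod (p ^ k)) ^ (k - 1) * c := by
    have h1 : ((u : ZMod (p ^ k)).cast : ZMod (p ^ (k - 1))) = 1 := by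
      rw [← ZMod.unitsMap_val hdvd, hu, Units.val_one]
    have h2 : ((((u : ZMod (p ^ k)).val : ℤ) - 1 : ℤ) : ZMod (p ^ (k - 1))) = 0 := by
      rw [ZMod.cast_eq_val] at h1
      push_cast
      rw [h1, sub_self]
    obtain ⟨c, hc⟩ := (ZMod.intCast_zmod_eq_zero_iff_dvd _ _).mp h2
    refine ⟨(c : ZMod (p ^ k)), ?_⟩
    have h3 := congr_arg (Int.cast : ℤ → ZMod (p ^ k)) hc
    push_cast at h3
    rw [ZMod.natCast_zmod_val] at h3
    rw [← h3]
    ring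
  have hcop : IsCoprime (d' : ℤ) (p ^ k : ℕ) :=
    Nat.isCoprime_iff_coprime.mpr ((hp.coprime_iff_not_dvd.mpr hd').symm.pow_right k)
  obtain ⟨a, b, hab⟩ := hcop
  have hpk : (p : ZMod (p ^ k)) ^ k = 0 := by
    rw [← Nat.cast_pow, ZMod.natCast_self]
  have hinv : (a : ZMod (p ^ k)) * (d' : ZMod (p ^ k)) = 1 := by
    have h3 := congr_arg (Int.cast : ℤ → ZMod (p ^ k)) hab
    push_cast at h3
    rwa [hpk, mul_zero, add_zero] at h3
  let y : ZMod (p ^ k) := (p : ZMod (p ^ k)) ^ (k - 1 - v) * (a * c)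
  have hy : (1 + y) ^ d = u := by
    obtain ⟨q, hq⟩ := Polynomial.powAddExpansion 1 y d
    have hy2 : y ^ 2 = 0 := by
      have : (k - 1 - v) * 2 = k + (k - 2 - 2 * v) := by omega
      rw [mul_pow, ← pow_mul, this, pow_add, hpk, zero_mul, zero_mul]
    have h4 : (p : ZMod (p ^ k)) ^ (k - 1) = p ^ v * p ^ (k - 1 - v) := by
      rw [← pow_add]
      congr 1
      omega
    rw [hq, hy2, hc, h4, hd]
    push_cast
    linear_combination (p : ZMod (p ^ k)) ^ v * p ^ (k - 1 - v) * c * hinv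
  have h0 : d ≠ 0 := by
    rintro rfl
    rcases mul_eq_zero.mp hd.symm with h | rfl
    · exact pow_ne_zero v hp.ne_zero h
    · exact hd' (dvd_zero p)
  obtain ⟨w, hw⟩ : IsUnit (1 + y) := (isUnit_pow_iff h0).mp (hy ▸ u.isUnit)
  obtain rfl : w ^ d = u := Units.ext (by rw [Units.val_pow_eq_pow_val, hw, hy])
  rw [MonoidHom.mem_ker, Units.ext_iff, MulChar.coe_toUnitHom, Units.val_pow_eq_pow_val, map_pow,
    ← MulChar.pow_apply_coe, hord, MulChar.one_apply_coe, Units.val_one]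

/-! ### The Euler product of the Dedekind zeta function -/

section IdealEulerProduct

variable {R : Type*} [CommRing R] [IsDedekindDomain R]

/-- The nonzero ideals all of whose prime factors lie in `T`. -/
def idealsFactoredOver (T : Finset (Ideal R)) : Set (Ideal R) :=
  {I | I ≠ 0 ∧ ∀ P : Ideal R, Prime P → P ∣ I → P ∈ T}

lemma idealsFactoredOver_empty : idealsFactoredOver (∅ : Finset (Ideal R)) = {1} := by
  ext I
  simp only [idealsFactoredOver, Finset.notMem_empty, imp_false, Set.mem_ofPred_eq,
    Set.mem_singleton_iff]
  constructor
  · rintro ⟨h0, h⟩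
    by_contra h1
    obtain ⟨P, hP, hPI⟩ := WfDvdMonoid.exists_irreducible_factor
      (fun h => h1 ((Ideal.isUnit_iff.mp h).trans Ideal.one_eq_top.symm)) h0
    exact h P hP.prime hPI
  · rintro rfl
    exact ⟨one_ne_zero, fun P hP h => hP.not_isUnit (isUnit_of_dvd_one h)⟩

/-- Splitting off the power of `P` from an ideal. -/
lemma exists_equiv_idealsFactoredOver_insert [DecidableEq (Ideal R)] {T : Finset (Ideal R)}
    {P : Ideal R} (hP : Prime P) (hPT : P ∉ T) :
    ∃ e : ℕ × idealsFactoredOver T ≃ idealsFactoredOver (insert P T),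
      ∀ x, (e x : Ideal R) = P ^ x.1 * x.2 := by
  have hnd (J : idealsFactoredOver T) : ¬ P ∣ J := fun h => hPT (J.2.2 P hP h)
  have hmem (x : ℕ × idealsFactoredOver T) :
      P ^ x.1 * (x.2 : Ideal R) ∈ idealsFactoredOver (insert P T) := by
    refine ⟨mul_ne_zero (pow_ne_zero _ hP.ne_zero) x.2.2.1, fun Q hQ hQd => ?_⟩
    rcases hQ.dvd_or_dvd hQd with h | h
    · exact Finset.mem_insert.mpr (Or.inl
        (associated_iff_eq.mp ((hQ.dvd_prime_iff_associated hP).mp (hQ.dvd_of_dvd_pow h))))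
    · exact Finset.mem_insert_of_mem (x.2.2.2 Q hQ h)
  refine ⟨Equiv.ofBijective (fun x => ⟨P ^ x.1 * x.2, hmem x⟩) ⟨?_, ?_⟩, fun x => rfl⟩
  · have key (a b : ℕ) (I J : idealsFactoredOver T) (hab : a ≤ b)
        (h : P ^ a * (I : Ideal R) = P ^ b * J) : a = b ∧ I = J := by
      obtain ⟨c, rfl⟩ := Nat.exists_eq_add_of_le hab
      rw [pow_add, mul_assoc, mul_right_inj' (pow_ne_zero _ hP.ne_zero)] at h
      rcases c with _ | c
      · exact ⟨rfl, Subtype.ext (by simpa using h)⟩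
      · exact absurd (h ▸ (dvd_pow_self P c.succ_ne_zero).mul_right _) (hnd I)
    rintro ⟨a, I⟩ ⟨b, J⟩ h
    have h' : P ^ a * (I : Ideal R) = P ^ b * J := congr_arg Subtype.val h
    rcases le_total a b with hab | hab
    · obtain ⟨rfl, rfl⟩ := key a b I J hab h'
      rfl
    · obtain ⟨rfl, rfl⟩ := key b a J I hab h'.symm
      rfl
  · rintro ⟨I, hI0, hI⟩
    obtain ⟨n, J, hJ, rfl⟩ := WfDvdMonoid.max_power_factor hI0 hP.irreducible
    refine ⟨⟨n, J, right_ne_zero_of_mul hI0, fun Q hQ hQJ => ?_⟩, rfl⟩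
    rcases Finset.mem_insert.mp (hI Q hQ (hQJ.mul_left _)) with rfl | h
    · exact absurd hQJ hJ
    · exact h

/-- The finite Euler product: summing a completely multiplicative function over the ideals
with prime factors in `T` gives a product of geometric series. -/
lemma hasSum_idealsFactoredOver {f : Ideal R →*₀ ℂ} (hf : ∀ P : Ideal R, Prime P → ‖f P‖ < 1)
    (T : Finset (Ideal R)) (hT : ∀ P ∈ T, Prime P) :
    Summable (fun I : idealsFactoredOver T => ‖f I‖) ∧
      HasSum (fun I : idealsFactoredOver T => f I) (∏ P ∈ T, (1 - f P)⁻¹) := by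
  classical
  induction T using Finset.induction with
  | empty =>
    rw [idealsFactoredOver_empty, Finset.prod_empty]
    exact ⟨(Set.finite_singleton 1).summable (‖f ·‖), map_one f ▸ hasSum_singleton 1 f⟩
  | insert P T hPT ih =>
    have hP : Prime P := hT P (Finset.mem_insert_self P T)
    obtain ⟨ih1, ih2⟩ := ih fun Q hQ => hT Q (Finset.mem_insert_of_mem hQ)
    obtain ⟨e, he⟩ := exists_equiv_idealsFactoredOver_insert hP hPT
    have hgeo := hasSum_geometric_of_norm_lt_one (hf P hP)
    have hgeo' : Summable fun n : ℕ => ‖f P ^ n‖ := by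
      simpa using summable_geometric_of_lt_one (norm_nonneg _) (hf P hP)
    rw [Finset.prod_insert hPT, ← e.hasSum_iff, ← e.summable_iff]
    simp only [Function.comp_def, he, map_mul, map_pow, norm_mul]
    have hsum := summable_mul_of_summable_norm (f := fun n : ℕ => f P ^ n)
      (g := fun I : idealsFactoredOver T => f I) hgeo' ih1
    have hsum' : Summable fun x : ℕ × idealsFactoredOver T => ‖f P ^ x.1‖ * ‖f x.2‖ :=
      hgeo'.mul_of_nonneg (g := fun I : idealsFactoredOver T => ‖f I‖) ih1
        (fun _ => norm_nonneg _) (fun _ => norm_nonneg _)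
    refine ⟨by simpa only [norm_pow] using hsum', ?_⟩
    exact HasSum.mul (f := fun n : ℕ => f P ^ n) (g := fun I : idealsFactoredOver T => f I)
      hgeo ih2 hsum

end IdealEulerProduct

section DedekindZeta

open NumberField Ideal Filter Topology

lemma primesOver_natPrime_injective {K : Type*} [Field K] {p q : ℕ} {P : Ideal (𝓞 K)}
    (hp : P ∈ primesOver (span {(p : ℤ)}) (𝓞 K)) (hq : P ∈ primesOver (span {(q : ℤ)}) (𝓞 K)) :
    p = q := by
  have h : span {(p : ℤ)} = span {(q : ℤ)} := hp.2.over.trans hq.2.over.symm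
  simpa using congr_arg absNorm h

variable (K : Type*) [Field K] [NumberField K]

lemma finite_primesOver_natPrime {p : ℕ} (hp : p.Prime) :
    (primesOver (span {(p : ℤ)}) (𝓞 K)).Finite := by
  have : Fact p.Prime := ⟨hp⟩
  exact IsDedekindDomain.primesOver_finite _ _

variable {K}

lemma prime_of_mem_primesOver_natPrime {p : ℕ} (hp : p.Prime) {P : Ideal (𝓞 K)}
    (hP : P ∈ primesOver (span {(p : ℤ)}) (𝓞 K)) : Prime P := by
  have : P.IsPrime := hP.1
  refine prime_of_isPrime (ne_bot_of_mem_primesOver ?_ hP) this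
  simpa using hp.ne_zero

lemma dvd_absNorm_of_mem_primesOver {p : ℕ} {P : Ideal (𝓞 K)}
    (hP : P ∈ primesOver (span {(p : ℤ)}) (𝓞 K)) : p ∣ absNorm P := by
  have h : absNorm (P.under ℤ) ∣ absNorm P := Int.absNorm_under_dvd_absNorm P
  have h2 := hP.2.over
  rw [← h2] at h
  simpa using h

lemma exists_natPrime_mem_primesOver {P : Ideal (𝓞 K)} (hP : Prime P) :
    ∃ p : Nat.Primes, P ∈ primesOver (span {((p : ℕ) : ℤ)}) (𝓞 K) := by
  have hPp : P.IsPrime := isPrime_of_prime hP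
  have : NeZero P := ⟨hP.ne_zero⟩
  refine ⟨⟨absNorm (P.under ℤ), Nat.absNorm_under_prime P⟩, hPp, ⟨?_⟩⟩
  simp

lemma one_lt_absNorm_of_prime {P : Ideal (𝓞 K)} (hP : Prime P) : 1 < absNorm P := by
  have h0 : absNorm P ≠ 0 := mt absNorm_eq_zero_iff.mp hP.ne_zero
  have h1 : absNorm P ≠ 1 := fun h => hP.not_isUnit (isUnit_iff.mpr (absNorm_eq_one_iff.mp h))
  omega

lemma norm_absNorm_cpow_neg_lt_one {P : Ideal (𝓞 K)} (hP : Prime P) {s : ℂ} (hs : 0 < s.re) :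
    ‖(absNorm P : ℂ) ^ (-s)‖ < 1 := by
  have h := one_lt_absNorm_of_prime hP
  rw [Complex.norm_natCast_cpow_of_pos (by omega), Complex.neg_re]
  exact Real.rpow_lt_one_of_one_lt_of_neg (by exact_mod_cast h) (by linarith)

lemma dedekindZetaInvFactor_eq_prod {p : ℕ} (hp : p.Prime) (s : ℂ) :
    dedekindZetaInvFactor K p s =
      ∏ P ∈ (finite_primesOver_natPrime K hp).toFinset, (1 - (absNorm P : ℂ) ^ (-s)) :=
  finprod_mem_eq_finite_toFinset_prod _ _

lemma dedekindZetaInvFactor_ne_zero {p : ℕ} (hp : p.Prime) {s : ℂ} (hs : 0 < s.re) :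
    dedekindZetaInvFactor K p s ≠ 0 := by
  rw [dedekindZetaInvFactor_eq_prod hp, Finset.prod_ne_zero_iff]
  intro P hP h
  have h1 := norm_absNorm_cpow_neg_lt_one
    (prime_of_mem_primesOver_natPrime hp ((Set.Finite.mem_toFinset _).mp hP)) hs
  rw [← sub_eq_zero.mp h, norm_one] at h1
  exact lt_irrefl _ h1

variable (K) in
/-- The number of ideals of norm at most `x` grows linearly, so the Dirichlet series defining the
Dedekind zeta function converges absolutely for `Re s > 1`. -/
lemma lSeriesSummable_card_absNorm {s : ℂ} (hs : 1 < s.re) :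
    LSeriesSummable (fun n => (Nat.card {I : Ideal (𝓞 K) // absNorm I = n} : ℂ)) s := by
  have h := LSeriesSummable_of_sum_norm_bigO_and_nonneg (r := 1) (s := s)
    (f := fun n => (Nat.card {I : Ideal (𝓞 K) // absNorm I = n} : ℝ)) ?_
    (fun _ => Nat.cast_nonneg _) zero_le_one hs
  · simpa using h
  refine Asymptotics.isBigO_of_div_tendsto_nhds ?_ (dedekindZeta_residue K) ?_
  · filter_upwards [eventually_gt_atTop 0] with n hn h
    rw [Real.rpow_one] at h
    exact absurd h (by positivity)
  refine ((Ideal.tendsto_norm_le_div_atTop₀ K).comp tendsto_natCast_atTop_atTop).congr fun n => ?_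
  simp only [Function.comp_apply, Nat.cast_le, ← Nat.cast_sum, Pi.div_apply, Real.rpow_one]
  congr
  rw [← add_left_inj 1, ← card_norm_le_eq_card_norm_le_add_one,
    show Finset.Icc 1 n = Finset.Ioc 0 n from Finset.Icc_succ_left_eq_Ioc _ _,
    show 1 = Nat.card {I : Ideal (𝓞 K) // absNorm I = 0} by simp [Ideal.absNorm_eq_zero_iff],
    Finset.sum_Ioc_add_eq_sum_Icc (n.zero_le),
    ← Finset.card_preimage_eq_sum_card_image_eq (fun k _ => finite_setOfPred_absNorm_eq k)]
  simp [Set.coe_eq_subtype]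

variable (K) in
/-- Grouping the ideals by their norm. -/
lemma summable_and_hasSum_absNorm_cpow {s : ℂ} (hs : 1 < s.re) :
    Summable (fun I : Ideal (𝓞 K) => ‖(absNorm I : ℂ) ^ (-s)‖) ∧
      HasSum (fun I : Ideal (𝓞 K) => (absNorm I : ℂ) ^ (-s)) (dedekindZeta K s) := by
  have hs0 : s ≠ 0 := fun h => by norm_num [h] at hs
  have hfin (n : ℕ) : Finite {I : Ideal (𝓞 K) // absNorm I = n} := finite_setOfPred_absNorm_eq n
  let e := Equiv.sigmaFiberEquiv (absNorm : Ideal (𝓞 K) → ℕ)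
  have hterm (n : ℕ) : LSeries.term (fun n => (Nat.card {I : Ideal (𝓞 K) // absNorm I = n} : ℂ)) s n
      = Nat.card {I : Ideal (𝓞 K) // absNorm I = n} * (n : ℂ) ^ (-s) := by
    rcases eq_or_ne n 0 with rfl | hn
    · simp [Complex.zero_cpow (neg_ne_zero.mpr hs0)]
    · rw [LSeries.term_of_ne_zero hn, Complex.cpow_neg, div_eq_mul_inv]
  have hL := lSeriesSummable_card_absNorm K hs
  have he (n : ℕ) (I : {I : Ideal (𝓞 K) // absNorm I = n}) : absNorm (e ⟨n, I⟩) = n := I.2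
  have h1 : Summable (fun I : Ideal (𝓞 K) => ‖(absNorm I : ℂ) ^ (-s)‖) := by
    rw [← e.summable_iff, Function.comp_def,
      summable_sigma_of_nonneg fun _ => norm_nonneg _]
    refine ⟨fun n => Summable.of_finite, ?_⟩
    refine hL.norm.congr fun n => ?_
    simp only [he, tsum_const, nsmul_eq_mul]
    rw [hterm, norm_mul, Complex.norm_natCast]
  refine ⟨h1, ?_⟩
  rw [← e.hasSum_iff]
  have h2 : Summable ((fun I : Ideal (𝓞 K) => (absNorm I : ℂ) ^ (-s)) ∘ e) :=
    e.summable_iff.mpr h1.of_norm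
  rw [h2.hasSum_iff, h2.tsum_sigma' fun n => Summable.of_finite]
  refine tsum_congr fun n => ?_
  simp only [Function.comp_apply, he, tsum_const, nsmul_eq_mul]
  rw [hterm]

variable (K) in
/-- The Euler product of `ζ_K`, with the primes grouped by the rational prime below. The partial
product over a finite set of rational primes is the sum over the ideals with prime factors above
them. -/
theorem hasProd_dedekindZetaInvFactor_inv {s : ℂ} (hs : 1 < s.re) :
    HasProd (fun p : Nat.Primes => (dedekindZetaInvFactor K p s)⁻¹) (dedekindZeta K s) := by
  classical
  have hs0 : s ≠ 0 := fun h => by norm_num [h] at hs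
  obtain ⟨hsum, hZ⟩ := summable_and_hasSum_absNorm_cpow K hs
  let f : Ideal (𝓞 K) →*₀ ℂ := (riemannZetaSummandHom hs0).comp absNorm
  have hf (I : Ideal (𝓞 K)) : f I = (absNorm I : ℂ) ^ (-s) := rfl
  let T (S : Finset Nat.Primes) : Finset (Ideal (𝓞 K)) :=
    S.biUnion fun p => (finite_primesOver_natPrime K p.2).toFinset
  have hT (S : Finset Nat.Primes) : ∀ P ∈ T S, Prime P := by
    intro P hP
    obtain ⟨p, -, hp⟩ := Finset.mem_biUnion.mp hP
    exact prime_of_mem_primesOver_natPrime p.2 ((Set.Finite.mem_toFinset _).mp hp)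
  have hprod (S : Finset Nat.Primes) : ∏ p ∈ S, (dedekindZetaInvFactor K p s)⁻¹ =
      ∑' I, (idealsFactoredOver (T S)).indicator (fun I => (absNorm I : ℂ) ^ (-s)) I := by
    have h := (hasSum_idealsFactoredOver (f := f)
      (fun P hP => norm_absNorm_cpow_neg_lt_one hP (by linarith)) (T S) (hT S)).2.tsum_eq
    simp only [hf] at h
    rw [← tsum_subtype, h, Finset.prod_biUnion]
    · exact Finset.prod_congr rfl fun p _ => by
        rw [dedekindZetaInvFactor_eq_prod p.2, Finset.prod_inv_distrib]
    · intro p _ q _ hpq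
      refine Finset.disjoint_left.mpr fun P hP hQ => hpq (Subtype.ext ?_)
      exact primesOver_natPrime_injective ((Set.Finite.mem_toFinset _).mp hP)
        ((Set.Finite.mem_toFinset _).mp hQ)
  rw [HasProd, SummationFilter.unconditional_filter]
  simp only [hprod]
  rw [← hZ.tsum_eq]
  refine tendsto_tsum_of_dominated_convergence hsum (fun I => ?_)
    (Eventually.of_forall fun S I => norm_indicator_le_norm_self _ _)
  rcases eq_or_ne I 0 with rfl | hI
  · simp [Set.indicator, Complex.zero_cpow (neg_ne_zero.mpr hs0)]
  -- All prime factors of `I` lie over the finitely many rational primes dividing its norm.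
  have hN : absNorm I ≠ 0 := mt absNorm_eq_zero_iff.mp hI
  have hev : ∀ᶠ S : Finset Nat.Primes in atTop, I ∈ idealsFactoredOver (T S) := by
    refine (eventually_ge_atTop ((absNorm I).primeFactors.subtype Nat.Prime)).mono fun S hS => ?_
    refine ⟨hI, fun P hP hPI => ?_⟩
    obtain ⟨p, hp⟩ := exists_natPrime_mem_primesOver hP
    exact Finset.mem_biUnion.mpr ⟨p, hS (Finset.mem_subtype.mpr (Nat.mem_primeFactors.mpr
      ⟨p.2, (dvd_absNorm_of_mem_primesOver hp).trans (map_dvd absNorm hPI), hN⟩)),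
      (Set.Finite.mem_toFinset _).mpr hp⟩
  exact tendsto_const_nhds.congr' (hev.mono fun S hS => (Set.indicator_of_mem hS _).symm)

variable (K) in
/-- Over `Re s > 1` the product of the factors `1 - N(P)⁻ˢ` over all primes `P` converges
absolutely, so it can be grouped by the rational primes below. -/
lemma multipliable_dedekindZetaInvFactor {s : ℂ} (hs : 1 < s.re) :
    Multipliable fun p : Nat.Primes => dedekindZetaInvFactor K p s := by
  let i : (Σ p : Nat.Primes, primesOver (span {((p : ℕ) : ℤ)}) (𝓞 K)) → Ideal (𝓞 K) := fun x => x.2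
  have hi : Function.Injective i := by
    rintro ⟨p, P, hP⟩ ⟨q, Q, hQ⟩ h
    obtain rfl : P = Q := h
    obtain rfl : p = q := Subtype.ext (primesOver_natPrime_injective hP hQ)
    rfl
  have h1 : Multipliable fun x => 1 + -(absNorm (i x) : ℂ) ^ (-s) := by
    refine multipliable_one_add_of_summable ?_
    simp only [norm_neg]
    exact (summable_and_hasSum_absNorm_cpow K hs).1.comp_injective hi
  have hfin (p : Nat.Primes) : Finite (primesOver (span {((p : ℕ) : ℤ)}) (𝓞 K)) :=
    (finite_primesOver_natPrime K p.2).to_subtype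
  have h2 := h1.sigma' fun p => Multipliable.of_finite
  refine h2.congr fun p => ?_
  rw [tprod_eq_finprod (Set.toFinite _),
    finprod_set_coe_eq_finprod_mem (primesOver (span {((p : ℕ) : ℤ)}) (𝓞 K))
      (f := fun P => 1 + -(absNorm P : ℂ) ^ (-s))]
  simp only [← sub_eq_add_neg]
  rfl

variable (K) in
/-- The Euler product of `ζ_K` and the product of the inverse factors both converge, so `ζ_K` is
invertible. -/
lemma dedekindZeta_ne_zero_and_hasProd {s : ℂ} (hs : 1 < s.re) :
    dedekindZeta K s ≠ 0 ∧
      HasProd (fun p : Nat.Primes => dedekindZetaInvFactor K p s) (dedekindZeta K s)⁻¹ := by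
  obtain ⟨Y, hY⟩ := multipliable_dedekindZetaInvFactor K hs
  have h : dedekindZeta K s * Y = 1 := by
    refine ((hasProd_dedekindZetaInvFactor_inv K hs).mul hY).unique ?_
    have h1 (p : Nat.Primes) :
        (dedekindZetaInvFactor K p s)⁻¹ * dedekindZetaInvFactor K p s = 1 :=
      inv_mul_cancel₀ (dedekindZetaInvFactor_ne_zero p.2 (by linarith))
    simp only [h1]
    exact hasProd_one
  exact ⟨left_ne_zero_of_mul_eq_one h, eq_inv_of_mul_eq_one_right h ▸ hY⟩

lemma differentiable_dedekindZetaInvFactor {p : ℕ} (hp : p.Prime) :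
    Differentiable ℂ (dedekindZetaInvFactor K p) := by
  have h : dedekindZetaInvFactor K p = fun s => ∏ P ∈ (finite_primesOver_natPrime K hp).toFinset,
      (1 - (absNorm P : ℂ) ^ (-s)) := funext fun s => dedekindZetaInvFactor_eq_prod hp s
  rw [h]
  refine Differentiable.fun_finsetProd fun P hP => ?_
  have hP' := one_lt_absNorm_of_prime
    (prime_of_mem_primesOver_natPrime hp ((Set.Finite.mem_toFinset _).mp hP))
  exact (differentiable_const 1).sub
    (differentiable_id.neg.const_cpow (Or.inl (Nat.cast_ne_zero.mpr (by omega))))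

end DedekindZeta

/-! ### Euler factors at the primes not dividing `d` -/

section Cyclotomic

open NumberField Ideal

/-- A prime `p` not dividing `t` is unramified in `ℚ(μ_t)`, and the residue degrees of the primes
above it are all equal to the order of `p` modulo `t`. -/
lemma dedekindZetaInvFactor_cyclotomicField {t p : ℕ} [NeZero t] (hp : p.Prime) (hpt : ¬ p ∣ t)
    (s : ℂ) : ∃ g : ℕ, g * orderOf (p : ZMod t) = t.totient ∧
      dedekindZetaInvFactor (CyclotomicField t ℚ) p s =
        (1 - ((p : ℂ) ^ (-s)) ^ orderOf (p : ZMod t)) ^ g := by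
  have : Fact p.Prime := ⟨hp⟩
  let K := CyclotomicField t ℚ
  have : IsCyclotomicExtension {t} ℚ K := CyclotomicField.isCyclotomicExtension t ℚ
  have : IsGalois ℚ K := IsCyclotomicExtension.isGalois {t} ℚ K
  refine ⟨(primesOver (span {(p : ℤ)}) (𝓞 K)).ncard, ?_, ?_⟩
  · have h := ncard_primesOver_mul_ramificationIdxIn_mul_inertiaDegIn (span {(p : ℤ)}) (𝓞 K)
      Gal(K/ℚ)
    rw [IsCyclotomicExtension.Rat.ramificationIdxIn_eq_of_not_dvd p K hpt,
      IsCyclotomicExtension.Rat.inertiaDegIn_eq_of_not_dvd p K hpt, one_mul,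
      IsGalois.card_aut_eq_finrank,
      IsCyclotomicExtension.finrank K (Polynomial.cyclotomic.irreducible_rat (NeZero.pos t))] at h
    exact h
  · rw [dedekindZetaInvFactor_eq_prod hp, Set.ncard_eq_toFinset_card _
      (finite_primesOver_natPrime K hp)]
    refine Finset.prod_eq_pow_card fun P hP => ?_
    obtain ⟨hP1, hP2⟩ := (Set.Finite.mem_toFinset _).mp hP
    rw [← absNorm_pow_inertiaDeg (span {(p : ℤ)}) P,
      IsCyclotomicExtension.Rat.inertiaDeg_eq_of_not_dvd p K P hpt]
    simp only [absNorm_span_singleton, Algebra.norm_self, MonoidHom.id_apply, Int.natAbs_natCast]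
    rw [Nat.cast_pow, ← Complex.cpow_nat_mul, ← Complex.natCast_cpow_natCast_mul]

end Cyclotomic

lemma norm_prod_sub_one_le {ι : Type*} (S : Finset ι) (u : ι → ℂ) {c δ : ℝ} (hc : 0 ≤ c)
    (hδ : 0 ≤ δ) (hδ1 : δ ≤ 1) (h : ∀ i ∈ S, ‖u i - 1‖ ≤ c * δ) :
    ‖∏ i ∈ S, u i - 1‖ ≤ ((1 + c) ^ S.card - 1) * δ := by
  classical
  induction S using Finset.induction with
  | empty => simp
  | insert i S hi ih =>
    have h1 := h i (Finset.mem_insert_self i S)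
    have h2 := ih fun j hj => h j (Finset.mem_insert_of_mem hj)
    have h3 : 0 ≤ (1 + c) ^ S.card - 1 := sub_nonneg.mpr (one_le_pow₀ (by linarith))
    rw [Finset.prod_insert hi, Finset.card_insert_of_notMem hi]
    generalize ∏ j ∈ S, u j = v at *
    calc ‖u i * v - 1‖ = ‖(u i - 1) * (v - 1) + (u i - 1) + (v - 1)‖ := by ring_nf
      _ ≤ ‖u i - 1‖ * ‖v - 1‖ + ‖u i - 1‖ + ‖v - 1‖ := by
        rw [← norm_mul]
        exact norm_add₃_le
      _ ≤ (c * δ) * ((((1 + c) ^ S.card - 1)) * 1) + c * δ + ((1 + c) ^ S.card - 1) * δ := by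
        gcongr
        exact h2.trans (by gcongr)
      _ = _ := by ring

/-- `(1 - x) ^ n = 1 - n x + O(x²)`. -/
lemma exists_one_sub_pow_eq {x : ℂ} (hx : ‖x‖ ≤ 1) (n : ℕ) :
    ∃ E : ℂ, ‖E‖ ≤ 3 ^ n ∧ (1 - x) ^ n = 1 - n * x + x ^ 2 * E := by
  induction n with
  | zero => exact ⟨0, by simp⟩
  | succ n ih =>
    obtain ⟨E, hE, h⟩ := ih
    refine ⟨E * (1 - x) + n, ?_, by rw [pow_succ, h]; push_cast; ring⟩
    have h1 : ‖1 - x‖ ≤ 2 := (norm_sub_le _ _).trans (by rw [norm_one]; linarith)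
    have h2 : (n : ℝ) ≤ 3 ^ n := by exact_mod_cast (Nat.lt_pow_self (by norm_num)).le
    calc ‖E * (1 - x) + n‖ ≤ ‖E‖ * ‖1 - x‖ + n := by
          refine (norm_add_le _ _).trans ?_
          rw [norm_mul, Complex.norm_natCast]
      _ ≤ 3 ^ n * 2 + 3 ^ n := by gcongr
      _ = 3 ^ (n + 1) := by ring

lemma norm_one_add_mul_one_sub_pow_sub_one_le {x : ℂ} (hx : ‖x‖ ≤ 1) {n d : ℕ} (hn : n ≤ d) :
    ‖(1 + n * x) * (1 - x) ^ n - 1‖ ≤ ((d : ℝ) ^ 2 + (1 + d) * 3 ^ d) * ‖x‖ ^ 2 := by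
  obtain ⟨E, hE, h⟩ := exists_one_sub_pow_eq hx n
  have hn' : (n : ℝ) ≤ d := by exact_mod_cast hn
  have h1 : ‖1 + n * x‖ ≤ 1 + d := by
    refine (norm_add_le _ _).trans ?_
    rw [norm_one, norm_mul, Complex.norm_natCast]
    nlinarith [norm_nonneg x, (Nat.cast_nonneg n : (0 : ℝ) ≤ n)]
  have h2 : ‖E‖ ≤ 3 ^ d := hE.trans (pow_le_pow_right₀ (by norm_num) hn)
  calc ‖(1 + n * x) * (1 - x) ^ n - 1‖ = ‖-(n : ℂ) ^ 2 * x ^ 2 + (1 + n * x) * E * x ^ 2‖ := by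
        rw [h]
        ring_nf
    _ ≤ (n : ℝ) ^ 2 * ‖x‖ ^ 2 + ‖1 + n * x‖ * ‖E‖ * ‖x‖ ^ 2 := by
        refine (norm_add_le _ _).trans ?_
        simp
    _ ≤ (d : ℝ) ^ 2 * ‖x‖ ^ 2 + (1 + d) * 3 ^ d * ‖x‖ ^ 2 := by gcongr
    _ = _ := by ring

lemma natCast_cpow_neg_natCast_mul (p k : ℕ) (s : ℂ) :
    (p : ℂ) ^ (-(k : ℂ) * s) = ((p : ℂ) ^ (-s)) ^ k := by
  rw [← Complex.cpow_nat_mul]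
  ring_nf

/-- Only finitely many powers of `p` are conductors of characters of order dividing `d`. -/
lemma kubotaLFactor_eq_sum {d p v d' : ℕ} (hp : p.Prime) (hd : d = p ^ v * d') (hd' : ¬ p ∣ d')
    (s : ℂ) : kubotaLFactor d p s =
      ∑ k ∈ Finset.range (2 * v + 2), (primitiveCount d (p ^ k) : ℂ) * ((p : ℂ) ^ (-s)) ^ k := by
  rw [kubotaLFactor, tsum_eq_sum (s := Finset.range (2 * v + 2))]
  · simp only [natCast_cpow_neg_natCast_mul]
  · intro k hk
    rw [Finset.mem_range, not_lt] at hk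
    rw [primitiveCount_prime_pow_eq_zero hp hd hd' hk, Nat.cast_zero, zero_mul]

lemma kubotaLFactor_of_not_dvd {d p : ℕ} (hp : p.Prime) (hpd : ¬ p ∣ d) (s : ℂ) :
    kubotaLFactor d p s = 1 + primitiveCount d p * (p : ℂ) ^ (-s) := by
  rw [kubotaLFactor_eq_sum hp (v := 0) (d' := d) (by simp) hpd]
  simp [Finset.sum_range_succ, primitiveCount_one]

lemma primitiveCount_prime_le {d p : ℕ} (hd : d ≠ 0) (hp : p.Prime) : primitiveCount d p ≤ d := by
  have h1 := primitiveCount_prime_add_one d hp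
  have h2 := Nat.le_of_dvd (Nat.pos_of_ne_zero hd) (Nat.gcd_dvd_right (p - 1) d)
  omega

/-- The fields `ℚ(μ_t)` with `1 < t ∣ d` in which `p` splits completely have total degree the number
of primitive characters modulo `p` of order dividing `d`. -/
lemma sum_totient_eq_primitiveCount {d p : ℕ} (hd : d ≠ 0) (hp : p.Prime) :
    ∑ t ∈ d.divisors with 1 < t ∧ t ∣ p - 1, t.totient = primitiveCount d p := by
  have h1 := primitiveCount_prime_add_one d hp
  have hg : (p - 1).gcd d ≠ 0 := by omega
  have h2 := Nat.sum_totient ((p - 1).gcd d)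
  rw [← Finset.add_sum_erase _ _ (Nat.one_mem_divisors.mpr hg), Nat.totient_one] at h2
  have h3 : (d.divisors.filter fun t => 1 < t ∧ t ∣ p - 1) = ((p - 1).gcd d).divisors.erase 1 := by
    ext t
    simp only [Finset.mem_filter, Nat.mem_divisors, Finset.mem_erase, Nat.dvd_gcd_iff]
    constructor
    · rintro ⟨⟨h, -⟩, h1, h'⟩
      exact ⟨h1.ne', ⟨h', h⟩, hg⟩
    · rintro ⟨h1, ⟨h', h⟩, -⟩
      have := Nat.pos_of_dvd_of_pos h (Nat.pos_of_ne_zero hd)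
      exact ⟨⟨h, hd⟩, by omega, h'⟩
  rw [h3]
  omega

/-- At `p ∤ d`, write `x = p⁻ˢ`. The fields `ℚ(μ_t)` in which `p` splits completely contribute
`(1 - x) ^ n`, which cancels the linear term of `L_{d,p} = 1 + n x`; in the other fields the residue
degree of `p` is at least `2`. -/
theorem exists_norm_kubotaLFactor_mul_sub_one_le {d : ℕ} (hd : d ≠ 0) :
    ∃ C : ℝ, 0 ≤ C ∧ ∀ p : ℕ, p.Prime → ¬ p ∣ d → ∀ s : ℂ, 0 < s.re →
      ‖kubotaLFactor d p s * kubotaZInvFactor d p s - 1‖ ≤ C * (p : ℝ) ^ (-2 * s.re) := by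
  set A : ℝ := (d : ℝ) ^ 2 + (1 + d) * 3 ^ d with hA
  set B : ℝ := (1 + 2 ^ d) ^ d with hB
  have hB1 : 0 ≤ B := by positivity
  have hAB : 0 ≤ A + B := by positivity
  refine ⟨(1 + (A + B)) ^ 2, by positivity, fun p hp hpd s hs => ?_⟩
  set x : ℂ := (p : ℂ) ^ (-s) with hx
  have hnx : ‖x‖ = (p : ℝ) ^ (-s.re) := by
    rw [hx, Complex.norm_natCast_cpow_of_pos hp.pos, Complex.neg_re]
  have hx1 : ‖x‖ ≤ 1 := by
    rw [hnx]
    exact Real.rpow_le_one_of_one_le_of_nonpos (by exact_mod_cast hp.one_le) (by linarith)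
  have hx2 : ‖x‖ ^ 2 = (p : ℝ) ^ (-2 * s.re) := by
    rw [hnx, ← Real.rpow_natCast, ← Real.rpow_mul (Nat.cast_nonneg p)]
    ring_nf
  have hδ0 : 0 ≤ ‖x‖ ^ 2 := by positivity
  have hδ1 : ‖x‖ ^ 2 ≤ 1 := pow_le_one₀ (norm_nonneg _) hx1
  rw [← hx2]
  have hmem {t : ℕ} (ht : t ∈ d.divisors) : NeZero t ∧ ¬ p ∣ t :=
    ⟨⟨(Nat.pos_of_mem_divisors ht).ne'⟩, fun h => hpd (h.trans (Nat.dvd_of_mem_divisors ht))⟩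
  have hsplit : ∏ t ∈ d.divisors with 1 < t ∧ t ∣ p - 1,
      dedekindZetaInvFactor (CyclotomicField t ℚ) p s = (1 - x) ^ primitiveCount d p := by
    rw [← sum_totient_eq_primitiveCount hd hp, ← Finset.prod_pow_eq_pow_sum]
    refine Finset.prod_congr rfl fun t ht => ?_
    obtain ⟨ht1, ht2, ht3⟩ := Finset.mem_filter.mp ht
    obtain ⟨_, hpt⟩ := hmem ht1
    obtain ⟨g, hg, h⟩ := dedekindZetaInvFactor_cyclotomicField hp hpt s
    have hord : orderOf (p : ZMod t) = 1 := by
      rw [orderOf_eq_one_iff, ← sub_eq_zero, ← Nat.cast_one, ← Nat.cast_sub hp.one_le,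
        ZMod.natCast_eq_zero_iff]
      exact ht3
    rw [hord, mul_one] at hg
    rw [h, hord, pow_one, hg]
  have hrest : ‖∏ t ∈ d.divisors with 1 < t ∧ ¬ t ∣ p - 1,
      dedekindZetaInvFactor (CyclotomicField t ℚ) p s - 1‖ ≤ B * ‖x‖ ^ 2 := by
    refine (norm_prod_sub_one_le _ _ (c := 2 ^ d) (by positivity) hδ0 hδ1 fun t ht => ?_).trans ?_
    · obtain ⟨ht1, ht2, ht3⟩ := Finset.mem_filter.mp ht
      obtain ⟨_, hpt⟩ := hmem ht1
      obtain ⟨g, hg, h⟩ := dedekindZetaInvFactor_cyclotomicField hp hpt s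
      have hf0 : orderOf (p : ZMod t) ≠ 0 := by
        intro h0
        rw [h0, mul_zero] at hg
        exact (Nat.totient_pos.mpr (NeZero.pos t)).ne hg
      have hf1 : orderOf (p : ZMod t) ≠ 1 := by
        rw [Ne, orderOf_eq_one_iff, ← sub_eq_zero, ← Nat.cast_one, ← Nat.cast_sub hp.one_le,
          ZMod.natCast_eq_zero_iff]
        exact ht3
      have hgd : g ≤ d := calc
        g ≤ g * orderOf (p : ZMod t) := Nat.le_mul_of_pos_right g (Nat.pos_of_ne_zero hf0)
        _ = t.totient := hg
        _ ≤ t := Nat.totient_le t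
        _ ≤ d := Nat.divisor_le ht1
      have hy : ‖(1 - x ^ orderOf (p : ZMod t)) - 1‖ ≤ 1 * ‖x‖ ^ 2 := by
        rw [sub_sub_cancel_left, norm_neg, norm_pow, one_mul]
        exact pow_le_pow_of_le_one (norm_nonneg _) hx1 (by omega)
      have h5 := norm_prod_sub_one_le (Finset.range g)
        (fun _ => 1 - x ^ orderOf (p : ZMod t)) zero_le_one hδ0 hδ1 fun _ _ => hy
      rw [Finset.prod_const, Finset.card_range] at h5
      rw [h]
      refine h5.trans (mul_le_mul_of_nonneg_right ?_ hδ0)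
      have : (1 + 1 : ℝ) ^ g ≤ 2 ^ d := by
        norm_num only
        exact pow_le_pow_right₀ (by norm_num) hgd
      linarith
    · refine mul_le_mul_of_nonneg_right ?_ hδ0
      have hcard : (d.divisors.filter fun t => 1 < t ∧ ¬ t ∣ p - 1).card ≤ d :=
        (Finset.card_filter_le _ _).trans (Nat.card_divisors_le_self d)
      have h6 : (1 + 2 ^ d : ℝ) ^ (d.divisors.filter fun t => 1 < t ∧ ¬ t ∣ p - 1).card ≤ B :=
        pow_le_pow_right₀ (by linarith [pow_pos (two_pos : (0 : ℝ) < 2) d]) hcard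
      linarith
  have hfac : kubotaZInvFactor d p s = (1 - x) ^ primitiveCount d p *
      ∏ t ∈ d.divisors with 1 < t ∧ ¬ t ∣ p - 1,
        dedekindZetaInvFactor (CyclotomicField t ℚ) p s := by
    rw [← hsplit, kubotaZInvFactor, ← Finset.filter_filter, ← Finset.filter_filter,
      Finset.prod_filter_mul_prod_filter_not]
  have hmain := norm_one_add_mul_one_sub_pow_sub_one_le hx1 (primitiveCount_prime_le hd hp)
  rw [kubotaLFactor_of_not_dvd hp hpd, hfac, ← mul_assoc, ← hx]
  have h7 := norm_prod_sub_one_le Finset.univ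
    ![(1 + primitiveCount d p * x) * (1 - x) ^ primitiveCount d p,
      ∏ t ∈ d.divisors with 1 < t ∧ ¬ t ∣ p - 1,
        dedekindZetaInvFactor (CyclotomicField t ℚ) p s] hAB hδ0 hδ1 (fun i _ => ?_)
  · rw [Fin.prod_univ_two, Finset.card_univ, Fintype.card_fin] at h7
    refine h7.trans (mul_le_mul_of_nonneg_right ?_ hδ0)
    linarith
  · fin_cases i
    · exact hmain.trans (mul_le_mul_of_nonneg_right (by linarith) hδ0)
    · exact hrest.trans (mul_le_mul_of_nonneg_right (le_add_of_nonneg_left (by positivity)) hδ0)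

/-! ### Euler products of `L_d` and `1 / Z_d` -/

section Kubota

open Filter Topology EulerProduct

/-- A nonnegative multiplicative function is summable if its sums over the powers of the primes `p`
exceed `1` by a summable amount: a partial sum over `n < N` is at most the product of these sums
over the primes below `N`. -/
lemma summable_of_multiplicative_of_tsum_pow_le {f a : ℕ → ℝ} (hf : ∀ n, 0 ≤ f n) (hf0 : f 0 = 0)
    (hf1 : f 1 = 1) (hmul : ∀ {m n : ℕ}, m.Coprime n → f (m * n) = f m * f n)
    (hpow : ∀ {p : ℕ}, p.Prime → Summable fun k => f (p ^ k)) (ha : ∀ n, 0 ≤ a n)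
    (hasum : Summable a) (hle : ∀ {p : ℕ}, p.Prime → ∑' k, f (p ^ k) ≤ 1 + a p) : Summable f := by
  refine summable_of_sum_range_le (c := Real.exp (∑' n, a n)) hf fun N => ?_
  obtain ⟨h1, h2⟩ := summable_and_hasSum_smoothNumbers_prod_primesBelow_tsum hf1 hmul
    (fun hp => by simpa only [Real.norm_of_nonneg (hf _)] using hpow hp) N
  calc ∑ n ∈ Finset.range N, f n = ∑ n ∈ (Finset.range N).subtype (· ∈ N.smoothNumbers), f n := by
        rw [Finset.sum_subtype_eq_sum_filter, Finset.sum_filter]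
        refine Finset.sum_congr rfl fun n hn => ?_
        split_ifs with h
        · rfl
        · rcases eq_or_ne n 0 with rfl | hn0
          · exact hf0
          · exact absurd (Nat.mem_smoothNumbers_of_lt (Nat.pos_of_ne_zero hn0)
              (Finset.mem_range.mp hn)) h
    _ ≤ ∏ p ∈ N.primesBelow, ∑' k, f (p ^ k) := sum_le_hasSum _ (fun _ _ => hf _) h2
    _ ≤ ∏ p ∈ N.primesBelow, Real.exp (a p) := by
        refine Finset.prod_le_prod (fun p _ => tsum_nonneg fun k => hf _) fun p hp => ?_
        refine (hle (Nat.prime_of_mem_primesBelow hp)).trans ?_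
        rw [add_comm]
        exact Real.add_one_le_exp _
    _ ≤ Real.exp (∑' n, a n) := by
        rw [← Real.exp_sum]
        exact Real.exp_le_exp.mpr (hasum.sum_le_tsum _ fun n _ => ha n)

lemma term_kubotaCoeff_mul (d : ℕ) (s : ℂ) {m n : ℕ} (h : m.Coprime n) :
    LSeries.term (kubotaCoeff d) s (m * n) =
      LSeries.term (kubotaCoeff d) s m * LSeries.term (kubotaCoeff d) s n := by
  rcases eq_or_ne m 0 with rfl | hm
  · simp
  rcases eq_or_ne n 0 with rfl | hn
  · simp
  rw [LSeries.term_of_ne_zero hm, LSeries.term_of_ne_zero hn,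
    LSeries.term_of_ne_zero (mul_ne_zero hm hn)]
  simp only [kubotaCoeff]
  rw [primitiveCount_mul d h, Nat.cast_mul, Nat.cast_mul, Complex.natCast_mul_natCast_cpow]
  exact mul_div_mul_comm _ _ _ _

lemma term_kubotaCoeff_one (d : ℕ) (s : ℂ) : LSeries.term (kubotaCoeff d) s 1 = 1 := by
  simp [LSeries.term_of_ne_zero, kubotaCoeff, primitiveCount_one]

lemma term_kubotaCoeff_prime_pow (d : ℕ) (s : ℂ) {p : ℕ} (hp : p.Prime) (k : ℕ) :
    LSeries.term (kubotaCoeff d) s (p ^ k) =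
      (primitiveCount d (p ^ k) : ℂ) * (p : ℂ) ^ (-(k : ℂ) * s) := by
  rw [LSeries.term_of_ne_zero (pow_ne_zero k hp.ne_zero), natCast_cpow_neg_natCast_mul,
    Complex.cpow_neg, inv_pow, div_eq_mul_inv, kubotaCoeff, Nat.cast_pow,
    ← Complex.natCast_cpow_natCast_mul, Complex.cpow_nat_mul]

lemma exists_eq_prime_pow_mul_not_dvd {d p : ℕ} (hd : d ≠ 0) (hp : p.Prime) :
    ∃ v d', d = p ^ v * d' ∧ ¬ p ∣ d' := by
  obtain ⟨v, d', h, h'⟩ := Nat.exists_eq_pow_mul_and_not_dvd hd p hp.ne_one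
  exact ⟨v, d', h', h⟩

theorem lSeriesSummable_kubotaCoeff {d : ℕ} (hd : d ≠ 0) {s : ℂ} (hs : 1 < s.re) :
    LSeriesSummable (kubotaCoeff d) s := by
  set f : ℕ → ℝ := fun n => ‖LSeries.term (kubotaCoeff d) s n‖ with hf
  have hzero {p : ℕ} (hp : p.Prime) : ∃ N, (¬ p ∣ d → N = 2) ∧ ∀ k, N ≤ k → f (p ^ k) = 0 := by
    have key {v d' : ℕ} (h : d = p ^ v * d') (h' : ¬ p ∣ d') :
        ∀ k, 2 * v + 2 ≤ k → f (p ^ k) = 0 := fun k hk => by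
      simp only [hf]
      rw [term_kubotaCoeff_prime_pow d s hp, primitiveCount_prime_pow_eq_zero hp h h' hk,
        Nat.cast_zero, zero_mul, norm_zero]
    by_cases hpd : p ∣ d
    · obtain ⟨v, d', h, h'⟩ := exists_eq_prime_pow_mul_not_dvd hd hp
      exact ⟨2 * v + 2, fun h => absurd hpd h, key h h'⟩
    · exact ⟨2, fun _ => rfl, by simpa using key (v := 0) (d' := d) (by simp) hpd⟩
  have hf1 : f 1 = 1 := by
    simp only [hf, term_kubotaCoeff_one, norm_one]
  -- The finitely many primes dividing `d` get their own (finite) bound.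
  let b : ℕ → ℝ := fun n => if n ∣ d then |∑' k, f (n ^ k)| else 0
  have hb (n : ℕ) : 0 ≤ b n := by
    simp only [b]
    split_ifs
    · exact abs_nonneg _
    · exact le_rfl
  have hbsum : Summable b := by
    refine summable_of_ne_finset_zero (s := d.divisors) fun n hn => if_neg fun h => ?_
    exact hn (Nat.mem_divisors.mpr ⟨h, hd⟩)
  have hsum : Summable fun n : ℕ => (d : ℝ) * (n : ℝ) ^ (-s.re) + b n :=
    ((Real.summable_nat_rpow.mpr (by linarith)).mul_left _).add hbsum
  refine Summable.of_norm (summable_of_multiplicative_of_tsum_pow_le (fun n => norm_nonneg _)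
    (by simp) hf1 (fun h => ?_) (fun hp => ?_) (fun n => ?_) hsum fun {p} hp => ?_)
  · rw [term_kubotaCoeff_mul d s h, norm_mul]
  · obtain ⟨N, -, hN⟩ := hzero hp
    exact summable_of_ne_finset_zero (s := Finset.range N) fun k hk =>
      hN k (by simpa using hk)
  · have := hb n
    positivity
  · have hp0 : 0 ≤ (d : ℝ) * (p : ℝ) ^ (-s.re) := by positivity
    by_cases hpd : p ∣ d
    · have : b p = |∑' k, f (p ^ k)| := if_pos hpd
      rw [this]
      linarith [le_abs_self (∑' k, f (p ^ k))]
    · obtain ⟨N, hN, hN'⟩ := hzero hp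
      rw [hN hpd] at hN'
      have h1 : ∑' k, f (p ^ k) = 1 + f p := by
        rw [tsum_eq_sum (s := Finset.range 2) fun k hk =>
          hN' k (not_lt.mp (mt Finset.mem_range.mpr hk))]
        simp [Finset.sum_range_succ, hf1]
      have h2 : f p ≤ (d : ℝ) * (p : ℝ) ^ (-s.re) := by
        simp only [hf]
        rw [LSeries.norm_term_eq, if_neg hp.ne_zero, Real.rpow_neg (Nat.cast_nonneg p),
          ← div_eq_mul_inv, kubotaCoeff, Complex.norm_natCast]
        gcongr
        exact_mod_cast primitiveCount_prime_le hd hp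
      have h3 := hb p
      change ∑' k, f (p ^ k) ≤ _
      linarith

theorem hasProd_kubotaLFactor {d : ℕ} (hd : d ≠ 0) {s : ℂ} (hs : 1 < s.re) :
    HasProd (fun p : Nat.Primes => kubotaLFactor d p s) (kubotaL d s) := by
  have h := eulerProduct_hasProd (f := LSeries.term (kubotaCoeff d) s)
    (term_kubotaCoeff_one d s) (term_kubotaCoeff_mul d s)
    (lSeriesSummable_kubotaCoeff hd hs).norm (LSeries.term_zero _ _)
  refine h.congr_fun fun p => ?_
  exact tsum_congr fun k => (term_kubotaCoeff_prime_pow d s p.2 k).symm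

theorem kubotaZ_ne_zero (d : ℕ) {s : ℂ} (hs : 1 < s.re) : kubotaZ d s ≠ 0 :=
  Finset.prod_ne_zero_iff.mpr fun _ _ => (dedekindZeta_ne_zero_and_hasProd _ hs).1

theorem hasProd_kubotaZInvFactor (d : ℕ) {s : ℂ} (hs : 1 < s.re) :
    HasProd (fun p : Nat.Primes => kubotaZInvFactor d p s) (kubotaZ d s)⁻¹ := by
  rw [kubotaZ, ← Finset.prod_inv_distrib]
  exact hasProd_prod fun _ _ => (dedekindZeta_ne_zero_and_hasProd _ hs).2

/-! ### Analytic continuation of `L_d / Z_d` -/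

lemma differentiable_kubotaLFactor_mul {d p : ℕ} (hd : d ≠ 0) (hp : p.Prime) :
    Differentiable ℂ fun s => kubotaLFactor d p s * kubotaZInvFactor d p s := by
  obtain ⟨v, d', h, h'⟩ := exists_eq_prime_pow_mul_not_dvd hd hp
  refine Differentiable.mul ?_ ?_
  · rw [show kubotaLFactor d p = _ from funext fun s => kubotaLFactor_eq_sum hp h h' s]
    refine Differentiable.fun_sum fun k _ => ((Differentiable.pow ?_ k).const_mul _)
    exact differentiable_id.neg.const_cpow (Or.inl (Nat.cast_ne_zero.mpr hp.ne_zero))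
  · exact Differentiable.fun_finsetProd fun t _ => differentiable_dedekindZetaInvFactor hp

/-- At `s = 1` the factor of `L_d` is a sum of nonnegative reals with first term `1`. -/
lemma kubotaLFactor_one_ne_zero {d p : ℕ} (hd : d ≠ 0) (hp : p.Prime) :
    kubotaLFactor d p 1 ≠ 0 := by
  obtain ⟨v, d', h, h'⟩ := exists_eq_prime_pow_mul_not_dvd hd hp
  have h1 : kubotaLFactor d p 1 = ((∑ k ∈ Finset.range (2 * v + 2),
      (primitiveCount d (p ^ k) : ℝ) * ((p : ℝ)⁻¹) ^ k : ℝ) : ℂ) := by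
    rw [kubotaLFactor_eq_sum hp h h', Complex.cpow_neg_one]
    push_cast
    rfl
  rw [h1, Complex.ofReal_ne_zero]
  refine (Finset.sum_pos' (fun k _ => by positivity) ⟨0, by simp, ?_⟩).ne'
  simp [primitiveCount_one]

lemma kubotaZInvFactor_ne_zero (d : ℕ) {p : ℕ} (hp : p.Prime) {s : ℂ} (hs : 0 < s.re) :
    kubotaZInvFactor d p s ≠ 0 :=
  Finset.prod_ne_zero_iff.mpr fun _ _ => dedekindZetaInvFactor_ne_zero hp hs

lemma finite_primes_dvd {d : ℕ} (hd : d ≠ 0) : {p : Nat.Primes | (p : ℕ) ∣ d}.Finite := by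
  refine Set.Finite.of_finite_image (f := ((↑) : Nat.Primes → ℕ)) ?_
    Subtype.val_injective.injOn
  refine (d.divisors.finite_toSet).subset ?_
  rintro _ ⟨p, hp, rfl⟩
  exact Nat.mem_divisors.mpr ⟨hp, hd⟩

/-- On a half plane `σ ≤ Re s` with `σ > 1/2`, all but finitely many Euler factors are
`1 + O(p ^ (-2σ))`, uniformly in `s`. -/
lemma exists_summable_bound {d : ℕ} (hd : d ≠ 0) {σ : ℝ} (hσ : 1 / 2 < σ) :
    ∃ u : Nat.Primes → ℝ, Summable u ∧ ∀ᶠ p : Nat.Primes in cofinite, ∀ s : ℂ, σ ≤ s.re →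
      ‖kubotaLFactor d p s * kubotaZInvFactor d p s - 1‖ ≤ u p := by
  obtain ⟨C, hC, h⟩ := exists_norm_kubotaLFactor_mul_sub_one_le hd
  refine ⟨fun p => C * (p : ℝ) ^ (-2 * σ),
    (Nat.Primes.summable_rpow.mpr (by linarith)).mul_left C, ?_⟩
  filter_upwards [(finite_primes_dvd hd).compl_mem_cofinite] with p hpd s hs
  refine (h p p.2 hpd s (by linarith)).trans ?_
  exact mul_le_mul_of_nonneg_left
    (Real.rpow_le_rpow_of_exponent_le (by exact_mod_cast p.2.one_le) (by linarith)) hC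

theorem summable_norm_kubotaLFactor_mul_sub_one {d : ℕ} (hd : d ≠ 0) {s : ℂ} (hs : 1 / 2 < s.re) :
    Summable fun p : Nat.Primes => ‖kubotaLFactor d p s * kubotaZInvFactor d p s - 1‖ := by
  obtain ⟨u, hu, h⟩ := exists_summable_bound hd hs
  exact hu.of_norm_bounded_eventually (h.mono fun p hp => by simpa using hp s le_rfl)

theorem hasProdLocallyUniformlyOn_kubotaLFactor_mul {d : ℕ} (hd : d ≠ 0) :
    HasProdLocallyUniformlyOn
      (fun (p : Nat.Primes) (s : ℂ) => kubotaLFactor d p s * kubotaZInvFactor d p s)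
      (fun s => ∏' p : Nat.Primes, kubotaLFactor d p s * kubotaZInvFactor d p s)
      {s : ℂ | 1 / 2 < s.re} := by
  refine hasProdLocallyUniformlyOn_of_forall_compact
    (isOpen_lt continuous_const Complex.continuous_re) fun S hS hSc => ?_
  obtain ⟨σ, hσ, hσS⟩ : ∃ σ : ℝ, 1 / 2 < σ ∧ ∀ s ∈ S, σ ≤ s.re := by
    rcases S.eq_empty_or_nonempty with rfl | hne
    · exact ⟨1, by norm_num, by simp⟩
    · obtain ⟨z, hz, hmin⟩ := hSc.exists_isMinOn hne Complex.continuous_re.continuousOn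
      exact ⟨z.re, hS hz, fun s hs => hmin hs⟩
  obtain ⟨u, hu, h⟩ := exists_summable_bound hd hσ
  have := hu.hasProdUniformlyOn_one_add hSc
    (f := fun (p : Nat.Primes) (s : ℂ) => kubotaLFactor d p s * kubotaZInvFactor d p s - 1)
    (h.mono fun p hp s hs => hp s (hσS s hs))
    fun p =>
      ((differentiable_kubotaLFactor_mul hd p.2).continuous.sub continuous_const).continuousOn
  simpa only [add_sub_cancel] using this

end Kubota

/-- `L_d / Z_d` extends to an analytic function on `Re s > 1/2`, which is given there by its Euler
product (converging absolutely and locally uniformly) and does not vanish at `s = 1`. -/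
theorem mainTheorem2 (d : ℕ) (hd : 1 ≤ d) :
    (∀ s : ℂ, 1 < s.re → LSeriesSummable (kubotaCoeff d) s ∧ kubotaZ d s ≠ 0) ∧
    ∃ H : ℂ → ℂ,
      AnalyticOnNhd ℂ H {s : ℂ | 1 / 2 < s.re} ∧
      (∀ s : ℂ, 1 < s.re → H s = kubotaL d s / kubotaZ d s) ∧
      (∀ s : ℂ, 1 / 2 < s.re →
        Summable fun p : Nat.Primes => ‖kubotaLFactor d p s * kubotaZInvFactor d p s - 1‖) ∧
      HasProdLocallyUniformlyOn
        (fun (p : Nat.Primes) (s : ℂ) => kubotaLFactor d p s * kubotaZInvFactor d p s) H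
        {s : ℂ | 1 / 2 < s.re} ∧
      H 1 ≠ 0 := by
  have hd0 : d ≠ 0 := by omega
  have hopen : IsOpen {s : ℂ | 1 / 2 < s.re} := isOpen_lt continuous_const Complex.continuous_re
  have hprod := hasProdLocallyUniformlyOn_kubotaLFactor_mul hd0
  refine ⟨fun s hs => ⟨lSeriesSummable_kubotaCoeff hd0 hs, kubotaZ_ne_zero d hs⟩,
    fun s => ∏' p : Nat.Primes, kubotaLFactor d p s * kubotaZInvFactor d p s, ?_, fun s hs => ?_,
    fun s hs => summable_norm_kubotaLFactor_mul_sub_one hd0 hs, hprod, ?_⟩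
  · refine DifferentiableOn.analyticOnNhd (TendstoLocallyUniformlyOn.differentiableOn hprod
      (Filter.Eventually.of_forall fun S => ?_) hopen) hopen
    exact (Differentiable.fun_finsetProd fun p _ =>
      differentiable_kubotaLFactor_mul hd0 p.2).differentiableOn
  · rw [div_eq_mul_inv]
    exact ((hasProd_kubotaLFactor hd0 hs).mul (hasProd_kubotaZInvFactor d hs)).tprod_eq
  · have h := tprod_one_add_ne_zero_of_summable
      (f := fun p : Nat.Primes => kubotaLFactor d p 1 * kubotaZInvFactor d p 1 - 1) (fun p => ?_)
      (summable_norm_kubotaLFactor_mul_sub_one hd0 (by norm_num))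
    · simpa only [add_sub_cancel] using h
    · rw [add_sub_cancel]
      exact mul_ne_zero (kubotaLFactor_one_ne_zero hd0 p.2)
        (kubotaZInvFactor_ne_zero d p.2 (by norm_num))
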